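/- **Setting.** Let $(\mathbf X_n)_{n\ge1}$ be spatial point processes (almost surely locally finite random subsets of $\mathbb R^d$) on one probability space, observed in windows $W_n\subset\mathbb R^d$, let $\theta_n$ be real numbers, and put $\tau_n=\theta_n|W_n|$, $N_n=\#(\mathbf X_n\cap W_n)$, $\mu_n=\mathbb E N_n$. Given covariates $z_1,\dots,z_p:\mathbb R^d\to\mathbb R$ and $I\subseteq\{1,\dots,p\}$, let $p_l=|I|+1$ and $\mathbf z(u)=[1,\{z_j(u)\}_{j\in I}]\in\mathbb R^{p_l}$. For $\beta\in\mathbb R^{p_l}$ let $\rho_n(u;\beta)=\theta_n\exp\{\beta^\top\mathbf z(u)\}$ and $$p_n(\mathbf X_n;\beta)=\Big\{\prod_{u\in\mathbf X_n\cap W_n}\rho_n(u;\beta)\Big\}\exp\Big\{|W_n|-\int_{W_n}\rho_n(u;\beta)\,du\Big\},\qquad \ell_n(\beta)=\sum_{u\in\mathbf X_n\cap W_n}\beta^\top\mathbf z(u)-\theta_n\int_{W_n}e^{\beta^\top\mathbf z(u)}\,du,$$ $$e_n(\beta)=\nabla\ell_n(\beta)=\sum_{u\in\mathbf X_n\cap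 W_n}\mathbf z(u)-\theta_n\int_{W_n}\mathbf z(u)e^{\beta^\top\mathbf z(u)}\,du,\qquad \mathbf S_n(\beta)=\theta_n\int_{W_n}\mathbf z(u)\mathbf z(u)^\top e^{\beta^\top\mathbf z(u)}\,du ,$$ so that $\log p_n(\mathbf X_n;\beta)=\ell_n(\beta)+|W_n|+N_n\log\theta_n$ when $\theta_n>0$. Let $\beta_n^*$ (for large $n$) be a maximizer of $\beta\mapsto\mathbb E\,\ell_n(\beta)$, let $\hat\beta_n$ be a maximizer of $\ell_n$ whenever one exists (and arbitrary otherwise), let $p(\cdot\mid\mathcal M_l)$ be a prior probability density on $\mathbb R^{p_l}$, and let $$p_n(\mathbf X_n\mid\mathcal M_l)=\int_{\mathbb R^{p_l}}p_n(\mathbf X_n;\beta)\,p(\beta\mid\mathcal M_l)\,d\beta,\qquad L_n=\int_{\mathbb R^{p_l}}e^{\ell_n(\beta)}\,p(\beta\mid\mathcal M_l)\,d\beta .$$ **Assumptions.** - (C1′) $\beta_n^*\to\beta^*$ for some $\beta^*\in\mathbb R^{p_l}$. - (C2) $\mathbf z$ is continuous, $0<\inf_u\|\mathbf z(u)\|$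 and $\sup_u\|\mathbf z(u)\|<\infty$. - (C3) $\tau_n$ is nondecreasing, $\tau_n\to\infty$, $\liminf_n\theta_n>0$, and every $W_n$ is convex and compact. - (C4) $\tau_n^{-1}e_n(\beta_n^*)\to0$ almost surely. - (C5) $\mathbf S_n(\beta)$ is positive definite for all $n$ and $\beta$; and there are $c,\kappa>0$ such that, for all large $n$ and every $\phi\in\mathbb R^{p_l}$ with $\|\phi\|=1$, there is a Borel set $B\subseteq W_n$ with $|B|\ge\kappa|W_n|$ and $|\phi^\top\mathbf z(u)|\ge c$ for all $u\in B$. - (C8) $p(\cdot\mid\mathcal M_l)$ is continuously differentiable on $\mathbb R^{p_l}$, and $p(\beta^*\mid\mathcal M_l)>0$. - (C9) $\mu_n\asymp\tau_n$, i.e. $\mu_n=\mathcal O(\tau_n)$ and $\tau_n=\mathcal O(\mu_n)$. **Conclusion.** Almost surely, $\hat\beta_n$ is the unique maximizer of $\ell_n$ for all large $n$ and, as $n\to\infty$, $$\log L_n=\ell_n(\hat\beta_n)-\frac{p_l}2\log\mu_n+\frac{p_l}2\log(2\pi)-\frac12\log\det\{\mu_n^{-1}\mathbf S_n(\hat\beta_n)\}+\log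 p(\hat\beta_n\mid\mathcal M_l)+\mathcal O(\mu_n^{-1/2}),$$ and $\log p_n(\mathbf X_n\mid\mathcal M_l)$ equals the same right-hand side plus the term $|W_n|+N_n\log\theta_n$, which depends neither on $\beta$ nor on the model. -/

import Mathlib

open MeasureTheory Filter Topology Asymptotics

noncomputable section

namespace PointProcessBIC

/-- Euclidean space `ℝ^d`, in which the points live. -/
abbrev Space (d : ℕ) : Type := EuclideanSpace ℝ (Fin d)

/-- The parameter space `ℝ^{p_l}` of the model given by the subset `I` of the `p` covariates:
one coordinate for the intercept (`none`) and one for each covariate in `I`. -/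
abbrev Param {p : ℕ} (I : Finset (Fin p)) : Type := EuclideanSpace ℝ (Option I)

/-- A spatial point process on `ℝ^d` under `P`: a random subset of `ℝ^d` that is almost surely
locally finite and whose counts in bounded Borel sets are random variables. -/
structure IsPointProcess {Ω : Type*} [MeasurableSpace Ω] {d : ℕ} (P : Measure Ω)
    (X : Ω → Set (Space d)) : Prop where
  locallyFinite : ∀ᵐ ω ∂P, ∀ B : Set (Space d), Bornology.IsBounded B → (X ω ∩ B).Finite
  measurable_count : ∀ B : Set (Space d), MeasurableSet B → Bornology.IsBounded B →
    Measurable fun ω => (X ω ∩ B).encard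

/-- The vector `z_l(u) = [1, {z_j(u)}_{j ∈ I}]`. -/
def covVec {d p : ℕ} (z : Fin p → Space d → ℝ) (I : Finset (Fin p)) (u : Space d) : Param I :=
  WithLp.toLp 2 fun i : Option I => i.elim 1 fun j => z j u

variable {d p : ℕ} {I : Finset (Fin p)}

/-- The log-linear intensity `ρ(u; β) = θ exp(βᵀ z_l(u))`. -/
def rho (θ : ℝ) (zl : Space d → Param I) (β : Param I) (u : Space d) : ℝ :=
  θ * Real.exp (inner ℝ β (zl u))

/-- The density (with respect to the unit rate Poisson process on `W`) of the Poisson process on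
`W` with intensity `ρ(·; β)`, at the part in `W` of the configuration `x`. -/
def poissonDensity (θ : ℝ) (W : Set (Space d)) (zl : Space d → Param I) (x : Set (Space d))
    (β : Param I) : ℝ :=
  (∏ᶠ u ∈ x ∩ W, rho θ zl β u) * Real.exp (volume.real W - ∫ u in W, rho θ zl β u)

/-- The Poisson log-likelihood `ℓ(β)` (without the terms of `log poissonDensity` that do not
depend on `β`). -/
def logLik (θ : ℝ) (W : Set (Space d)) (zl : Space d → Param I) (x : Set (Space d))
    (β : Param I) : ℝ :=
  (∑ᶠ u ∈ x ∩ W, inner ℝ β (zl u)) - θ * ∫ u in W, Real.exp (inner ℝ β (zl u))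

/-- The score `e(β)`, the gradient of `ℓ` at `β`. -/
def score (θ : ℝ) (W : Set (Space d)) (zl : Space d → Param I) (x : Set (Space d))
    (β : Param I) : Param I :=
  (∑ᶠ u ∈ x ∩ W, zl u) - θ • ∫ u in W, Real.exp (inner ℝ β (zl u)) • zl u

/-- The sensitivity matrix `S(β)`, minus the (deterministic) Hessian of `ℓ` at `β`. -/
def sensitivity (θ : ℝ) (W : Set (Space d)) (zl : Space d → Param I) (β : Param I) :
    Matrix (Option I) (Option I) ℝ :=
  Matrix.of fun i j => θ * ∫ u in W, zl u i * zl u j * Real.exp (inner ℝ β (zl u))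

/-- `b` is a point of global maximum of `f`. -/
def IsArgmax {E : Type*} (f : E → ℝ) (b : E) : Prop := ∀ b', f b' ≤ f b

/-- The marginal density `p(x | M_l) = ∫ p(x; β) π(β) dβ` of the data under the prior `π`. -/
def marginalDensity (θ : ℝ) (W : Set (Space d)) (zl : Space d → Param I) (prior : Param I → ℝ)
    (x : Set (Space d)) : ℝ :=
  ∫ β : Param I, poissonDensity θ W zl x β * prior β

/-- The marginal density when the factors of the Poisson density that do not depend on `β` are
left out, that is, when `p(x; β)` stands for `exp (ℓ(β))`. -/
def marginalLik (θ : ℝ) (W : Set (Space d)) (zl : Space d → Param I) (prior : Param I → ℝ)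
    (x : Set (Space d)) : ℝ :=
  ∫ β : Param I, Real.exp (logLik θ W zl x β) * prior β

/-- The expected number of points in `W`. -/
def meanCount {Ω : Type*} [MeasurableSpace Ω] (P : Measure Ω) (X : Ω → Set (Space d))
    (W : Set (Space d)) : ℝ :=
  ∫ ω, ((X ω ∩ W).ncard : ℝ) ∂P

/-- The terms of the Laplace expansion, at the parameter value `b`:
`ℓ(b) - (p_l/2) log μ + (p_l/2) log 2π - (1/2) log det (μ⁻¹ S(b)) + log π(b)`. -/
def laplaceTerms (θ : ℝ) (W : Set (Space d)) (zl : Space d → Param I) (prior : Param I → ℝ)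
    (μ : ℝ) (x : Set (Space d)) (b : Param I) : ℝ :=
  logLik θ W zl x b - ((I.card : ℝ) + 1) / 2 * Real.log μ
    + ((I.card : ℝ) + 1) / 2 * Real.log (2 * Real.pi)
    - 1 / 2 * Real.log (μ⁻¹ • sensitivity θ W zl b).det
    + Real.log (prior b)

end PointProcessBIC

end

/-! The data enter `logLik` only linearly in `β`, so expansion around any `b` is exact: ℓ(b+h) =
ℓ(b) + ⟨h, e(b)⟩ − D_b(h), where D_b(h) = θ∫ e^{⟨b,z⟩}(e^t − 1 − t) with t = ⟨h,z⟩ (`logLik_add`).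
The drop D_b is deterministic, and (C5) makes it at least τ c₁ ‖h‖ min(1,‖h‖), with c₁ uniform for
`b` in a bounded set (`le_logLikDrop`).

Maximizers: as soon as ‖e(b₀)‖ < τ c₁ δ, the drop beats the linear term outside the δ-ball around
b₀. At b₀ = β*ₙ, (C4) then gives existence and, with (C1′), consistency. At a maximizer the score
vanishes, so the drop is the whole deficit and its positivity gives uniqueness.

Laplace: around the maximizer, Lₙ = e^{ℓ(β̂)} ∫ e^{−D(h)} p(β̂+h) dh. On the unit ball, D differs
from Q(h) = hᵀSh/2 by O(τ‖h‖³) and the prior from p(β̂) by O(‖h‖); rescaling h by √τ turns both into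
relative errors O(τ^{-1/2}). Outside, e^{−D} ≤ e^{−τc₁} while the prior has total mass 1, so this
part is exponentially small (`exists_laplace_bound`). The Gaussian integral of e^{−Q} yields the
determinant, and (C9) converts τ^{-1/2} to μ^{-1/2}. -/

namespace PointProcessBIC

/-! ### Elementary inequalities for the exponential and the logarithm -/

/-- The remainder `eᵗ - 1 - t` of the first order Taylor expansion of the exponential. -/
noncomputable def expRem (t : ℝ) : ℝ := Real.exp t - 1 - t

lemma continuous_expRem : Continuous expRem := by
  unfold expRem; fun_prop

lemma expRem_nonneg (t : ℝ) : 0 ≤ expRem t := by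
  unfold expRem; linarith [Real.add_one_le_exp t]

/-- Growth is quadratic near 0 but only linear as `t → -∞`, whence the minimum. For `t ≥ -2`,
squaring `1 + t/2 ≤ exp (t/2)` gives `t²/4`; for `t ≤ -2`, dropping `exp t` leaves `|t| - 1 ≥
|t|/2`. -/
lemma min_le_expRem {t x : ℝ} (hx : 0 ≤ x) (hxt : x ≤ |t|) :
    min (x ^ 2 / 4) (x / 2) ≤ expRem t := by
  unfold expRem
  rcases le_total (-2) t with h | h
  · refine (min_le_left _ _).trans ?_
    have h1 : 1 + t / 2 ≤ Real.exp (t / 2) := by linarith [Real.add_one_le_exp (t / 2)]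
    have h2 : Real.exp t = Real.exp (t / 2) ^ 2 := by rw [← Real.exp_nat_mul]; congr 1; push_cast; ring
    have h3 : (1 + t / 2) ^ 2 ≤ Real.exp (t / 2) ^ 2 := pow_le_pow_left₀ (by linarith) h1 2
    have h4 : x ^ 2 ≤ t ^ 2 := by rw [← sq_abs t]; exact pow_le_pow_left₀ hx hxt 2
    nlinarith
  · refine (min_le_right _ _).trans ?_
    rw [abs_of_nonpos (by linarith)] at hxt
    linarith [Real.exp_pos t]

lemma abs_exp_sub_sum_le (t : ℝ) (n : ℕ) :
    |Real.exp t - ∑ m ∈ Finset.range n, t ^ m / m.factorial| ≤ |t| ^ n * Real.exp |t| := by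
  have := Complex.norm_exp_sub_sum_le_norm_mul_exp (t : ℂ) n
  have h : Complex.exp t - ∑ m ∈ Finset.range n, (t : ℂ) ^ m / (m.factorial : ℂ)
      = ((Real.exp t - ∑ m ∈ Finset.range n, t ^ m / m.factorial : ℝ) : ℂ) := by push_cast; rfl
  rwa [h, Complex.norm_real, Complex.norm_real, Real.norm_eq_abs, Real.norm_eq_abs] at this

lemma expRem_le (t : ℝ) : expRem t ≤ t ^ 2 * Real.exp |t| := by
  have := (le_abs_self _).trans (abs_exp_sub_sum_le t 2)
  simp only [Finset.sum_range_succ, Finset.sum_range_zero, sq_abs] at this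
  norm_num at this
  unfold expRem; linarith

lemma abs_expRem_sub_le (t : ℝ) : |expRem t - t ^ 2 / 2| ≤ |t| ^ 3 * Real.exp |t| := by
  have := abs_exp_sub_sum_le t 3
  simp only [Finset.sum_range_succ, Finset.sum_range_zero] at this
  norm_num at this
  unfold expRem
  convert this using 2
  ring

/-- The common lower bound `m` is kept so that the Gaussian decay survives when two exponents are
compared. -/
lemma abs_exp_neg_sub_exp_neg_le {x y m : ℝ} (hx : m ≤ x) (hy : m ≤ y) :
    |Real.exp (-x) - Real.exp (-y)| ≤ |x - y| * Real.exp (-m) := by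
  wlog h : x ≤ y generalizing x y
  · rw [abs_sub_comm, abs_sub_comm x y]
    exact this hy hx (le_of_not_ge h)
  have h1 : Real.exp (-y) = Real.exp (-x) * Real.exp (-(y - x)) := by
    rw [← Real.exp_add]; congr 1; ring
  have h2 : 1 - (y - x) ≤ Real.exp (-(y - x)) := by linarith [Real.add_one_le_exp (-(y - x))]
  have h3 : Real.exp (-x) ≤ Real.exp (-m) := Real.exp_le_exp.2 (by linarith)
  rw [abs_of_nonneg (sub_nonneg.2 (Real.exp_le_exp.2 (by linarith))),
    abs_of_nonpos (by linarith), h1]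
  nlinarith [Real.exp_pos (-x)]

lemma abs_log_le_two_mul {x : ℝ} (hx : |x - 1| ≤ 1 / 2) : |Real.log x| ≤ 2 * |x - 1| := by
  have hx' := abs_le.1 hx
  have hpos : 0 < x := by linarith
  have h1 := Real.log_le_sub_one_of_pos hpos
  have h2 := Real.one_sub_inv_le_log_of_pos hpos
  have h3 : |1 - x⁻¹| ≤ 2 * |x - 1| := by
    have : 1 - x⁻¹ = x⁻¹ * (x - 1) := by field_simp
    rw [this, abs_mul, abs_of_pos (inv_pos.2 hpos)]
    gcongr
    rw [inv_le_comm₀ hpos (by norm_num)]; linarith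
  rw [abs_le]
  constructor
  · linarith [neg_abs_le (1 - x⁻¹)]
  · linarith [le_abs_self (x - 1), abs_nonneg (x - 1)]

/-! ### Gaussian moments and the Gaussian integral -/

section Gaussian

variable {V : Type*} [NormedAddCommGroup V] [InnerProductSpace ℝ V] [FiniteDimensional ℝ V]
  [MeasurableSpace V] [BorelSpace V]

lemma integrable_exp_neg_mul_sq_norm {c : ℝ} (hc : 0 < c) :
    Integrable fun v : V => Real.exp (-(c * ‖v‖ ^ 2)) := by
  refine Integrable.of_integral_ne_zero ?_
  have h := GaussianFourier.integral_rexp_neg_mul_sq_norm (V := V) hc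
  simp only [neg_mul] at h
  rw [h]
  positivity

lemma integral_exp_neg_mul_sq_norm_pos {c : ℝ} (hc : 0 < c) :
    0 < ∫ v : V, Real.exp (-(c * ‖v‖ ^ 2)) := by
  have h := GaussianFourier.integral_rexp_neg_mul_sq_norm (V := V) hc
  simp only [neg_mul] at h
  rw [h]
  positivity

lemma integrable_pow_mul_exp_neg_mul_sq_norm {c : ℝ} (hc : 0 < c) (k : ℕ) :
    Integrable fun v : V => ‖v‖ ^ k * Real.exp (-(c * ‖v‖ ^ 2)) := by
  have hmeas : AEStronglyMeasurable (fun v : V => ‖v‖ ^ k * Real.exp (-(c * ‖v‖ ^ 2))) volume := by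
    exact Continuous.aestronglyMeasurable (by fun_prop)
  -- Half of the exponent absorbs the polynomial, by `s ^ k ≤ k! * exp s` at `s = c/2 * ‖v‖²`.
  refine ((integrable_exp_neg_mul_sq_norm (V := V) (half_pos hc)).const_mul
    (1 + k.factorial * (2 / c) ^ k)).mono' hmeas (ae_of_all _ fun v => ?_)
  rw [Real.norm_of_nonneg (by positivity)]
  have h1 : ‖v‖ ^ k ≤ 1 + (‖v‖ ^ 2) ^ k := by
    rcases le_total ‖v‖ 1 with h | h
    · have := pow_le_one₀ (n := k) (norm_nonneg v) h
      have : 0 ≤ (‖v‖ ^ 2) ^ k := by positivity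
      linarith
    · have := pow_le_pow_left₀ (norm_nonneg v) (le_self_pow₀ h two_ne_zero) k
      linarith
  have h2 : (‖v‖ ^ 2) ^ k ≤ k.factorial * (2 / c) ^ k * Real.exp (c / 2 * ‖v‖ ^ 2) := by
    have h := Real.pow_div_factorial_le_exp (c / 2 * ‖v‖ ^ 2) (by positivity) k
    rw [div_le_iff₀ (by positivity)] at h
    calc (‖v‖ ^ 2) ^ k = (2 / c) ^ k * (c / 2 * ‖v‖ ^ 2) ^ k := by
          rw [← mul_pow]; congr 1; field_simp
      _ ≤ (2 / c) ^ k * (Real.exp (c / 2 * ‖v‖ ^ 2) * k.factorial) := by gcongr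
      _ = _ := by ring
  have h3 : (1 : ℝ) ≤ Real.exp (c / 2 * ‖v‖ ^ 2) := Real.one_le_exp (by positivity)
  have h4 : Real.exp (-(c / 2 * ‖v‖ ^ 2))
      = Real.exp (c / 2 * ‖v‖ ^ 2) * Real.exp (-(c * ‖v‖ ^ 2)) := by
    rw [← Real.exp_add]; congr 1; ring
  rw [h4, ← mul_assoc]
  gcongr
  nlinarith

/-- The scaling law of the moments of a Gaussian. -/
lemma integral_pow_mul_exp_neg_mul_sq_norm_scale (c : ℝ) (k : ℕ) {t : ℝ} (ht : 0 < t) :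
    ∫ v : V, ‖v‖ ^ k * Real.exp (-(t * c * ‖v‖ ^ 2))
      = (√t ^ Module.finrank ℝ V)⁻¹ * (√t ^ k)⁻¹ * ∫ v : V, ‖v‖ ^ k * Real.exp (-(c * ‖v‖ ^ 2)) := by
  have hs : 0 < √t := Real.sqrt_pos.2 ht
  have h := Measure.integral_comp_smul (volume : Measure V)
    (fun v => ‖v‖ ^ k * Real.exp (-(c * ‖v‖ ^ 2))) (√t)
  rw [abs_of_pos (by positivity), smul_eq_mul] at h
  rw [mul_right_comm, ← h, mul_comm _ (√t ^ k)⁻¹, ← integral_const_mul]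
  congr 1 with v
  rw [norm_smul, Real.norm_of_nonneg hs.le, mul_pow, mul_pow, Real.sq_sqrt ht.le]
  rw [← mul_assoc, inv_mul_cancel_left₀ (by positivity)]
  ring_nf

end Gaussian

open scoped MatrixOrder Matrix.Norms.L2Operator in
/-- The Gaussian integral with a positive definite precision matrix. -/
lemma integral_exp_neg_half_quadForm {ι : Type*} [Fintype ι] [DecidableEq ι] {S : Matrix ι ι ℝ}
    (hS : S.PosDef) :
    ∫ h : EuclideanSpace ℝ ι, Real.exp (-((h.ofLp ⬝ᵥ S.mulVec h.ofLp) / 2))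
      = (2 * Real.pi) ^ ((Fintype.card ι : ℝ) / 2) * (√S.det)⁻¹ := by
  -- With `S = Aᵀ A` the quadratic form is `‖A h‖²`, so the linear change of variables by `A`
  -- reduces to the standard Gaussian.
  obtain ⟨A, hA⟩ := CStarAlgebra.nonneg_iff_eq_star_mul_self.mp hS.posSemidef.nonneg
  have hdet : S.det = A.det ^ 2 := by
    rw [hA, Matrix.star_eq_conjTranspose, Matrix.det_mul, Matrix.det_conjTranspose, star_trivial, sq]
  have hA0 : A.det ≠ 0 := by
    intro h
    have := hS.det_pos
    rw [hdet, h] at this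
    simp at this
  have hquad : ∀ h : EuclideanSpace ℝ ι,
      h.ofLp ⬝ᵥ S.mulVec h.ofLp = ‖Matrix.toEuclideanLin A h‖ ^ 2 := by
    intro h
    rw [EuclideanSpace.real_norm_sq_eq, hA, ← Matrix.mulVec_mulVec, Matrix.dotProduct_mulVec,
      Matrix.star_eq_conjTranspose, Matrix.conjTranspose_eq_transpose_of_trivial,
      Matrix.vecMul_transpose]
    simp [dotProduct, Matrix.toLpLin_apply, sq]
  have hmap := Measure.map_linearMap_addHaar_eq_smul_addHaar
    (volume : Measure (EuclideanSpace ℝ ι)) (f := Matrix.toEuclideanLin A)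
    (by rwa [LinearMap.det_toLpLin])
  have hcv : ∫ h : EuclideanSpace ℝ ι, Real.exp (-(1 / 2) * ‖Matrix.toEuclideanLin A h‖ ^ 2)
      = |A.det|⁻¹ * ∫ h : EuclideanSpace ℝ ι, Real.exp (-(1 / 2) * ‖h‖ ^ 2) := by
    have h1 := integral_map (μ := (volume : Measure (EuclideanSpace ℝ ι)))
      (φ := Matrix.toEuclideanLin A) (f := fun h => Real.exp (-(1 / 2) * ‖h‖ ^ 2))
      (LinearMap.continuous_of_finiteDimensional _).aemeasurable
      (Continuous.aestronglyMeasurable (by fun_prop))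
    rw [← h1, hmap, integral_smul_measure, LinearMap.det_toLpLin,
      ENNReal.toReal_ofReal (abs_nonneg _), abs_inv, smul_eq_mul]
  rw [GaussianFourier.integral_rexp_neg_mul_sq_norm (by norm_num)] at hcv
  have : ∀ h : EuclideanSpace ℝ ι, Real.exp (-((h.ofLp ⬝ᵥ S.mulVec h.ofLp) / 2))
      = Real.exp (-(1 / 2) * ‖Matrix.toEuclideanLin A h‖ ^ 2) := by
    intro h
    rw [hquad]; congr 1; ring
  simp_rw [this]
  rw [hcv, hdet, Real.sqrt_sq_eq_abs, mul_comm, finrank_euclideanSpace]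
  congr 2
  ring

/-- Comparison of the integrands of a Laplace integral and of its Gaussian approximation. -/
lemma abs_exp_mul_sub_exp_mul_le {V : Type*} [NormedAddCommGroup V]
    {c C K p₁ t : ℝ} (hc : 0 < c) (hC : 0 ≤ C) (hK : 0 ≤ K)
    (ht : 0 < t) {f : V → ℝ} (hf : ∀ v, 0 ≤ f v) {D Q : V → ℝ} {b : V}
    (hD : ∀ h, t * c * (‖h‖ * min 1 ‖h‖) ≤ D h) (hQ : ∀ h, t * c * ‖h‖ ^ 2 ≤ Q h)
    (hDQ : ∀ h, ‖h‖ ≤ 1 → |D h - Q h| ≤ t * C * ‖h‖ ^ 3)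
    (hfK : ∀ h, ‖h‖ ≤ 1 → |f (b + h) - f b| ≤ K * ‖h‖) (hfb : f b ≤ p₁) (h : V) :
    |Real.exp (-D h) * f (b + h) - f b * Real.exp (-Q h)|
      ≤ p₁ * C * t * (‖h‖ ^ 3 * Real.exp (-(t * c * ‖h‖ ^ 2)))
        + (K + p₁) * (‖h‖ ^ 1 * Real.exp (-(t * c * ‖h‖ ^ 2)))
        + Real.exp (-(t * c)) * f (b + h) := by
  have hp₁ : 0 ≤ p₁ := (hf b).trans hfb
  have hQe : Real.exp (-Q h) ≤ Real.exp (-(t * c * ‖h‖ ^ 2)) := Real.exp_le_exp.2 (by linarith [hQ h])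
  rw [pow_one]
  rcases le_total ‖h‖ 1 with h1 | h1
  · have hDh : t * c * ‖h‖ ^ 2 ≤ D h := by
      have := hD h
      rwa [min_eq_right h1, ← sq] at this
    have hDe : Real.exp (-D h) ≤ Real.exp (-(t * c * ‖h‖ ^ 2)) := Real.exp_le_exp.2 (by linarith)
    have key : Real.exp (-D h) * f (b + h) - f b * Real.exp (-Q h)
        = f b * (Real.exp (-D h) - Real.exp (-Q h)) + Real.exp (-D h) * (f (b + h) - f b) := by ring
    have e1 : |f b * (Real.exp (-D h) - Real.exp (-Q h))|
        ≤ p₁ * (t * C * ‖h‖ ^ 3 * Real.exp (-(t * c * ‖h‖ ^ 2))) := by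
      rw [abs_mul, abs_of_nonneg (hf b)]
      gcongr
      refine (abs_exp_neg_sub_exp_neg_le hDh (hQ h)).trans ?_
      gcongr
      exact hDQ h h1
    have e2 : |Real.exp (-D h) * (f (b + h) - f b)|
        ≤ Real.exp (-(t * c * ‖h‖ ^ 2)) * (K * ‖h‖) := by
      rw [abs_mul, abs_of_pos (Real.exp_pos _)]
      gcongr
      exact hfK h h1
    have e3 : 0 ≤ Real.exp (-(t * c)) * f (b + h) := mul_nonneg (Real.exp_pos _).le (hf _)
    have e4 : 0 ≤ p₁ * (‖h‖ * Real.exp (-(t * c * ‖h‖ ^ 2))) := by positivity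
    rw [key]
    refine (abs_add_le _ _).trans ?_
    nlinarith
  · have hDe : Real.exp (-D h) ≤ Real.exp (-(t * c)) := by
      refine Real.exp_le_exp.2 ?_
      have := hD h
      rw [min_eq_left h1, mul_one] at this
      nlinarith [mul_pos ht hc]
    have e1 : Real.exp (-D h) * f (b + h) ≤ Real.exp (-(t * c)) * f (b + h) :=
      mul_le_mul_of_nonneg_right hDe (hf _)
    -- Since `1 ≤ ‖h‖`, the Gaussian tail can be charged to the first moment; this is the `p₁` in
    -- the coefficient `K + p₁`.
    have e2 : f b * Real.exp (-Q h) ≤ p₁ * (‖h‖ * Real.exp (-(t * c * ‖h‖ ^ 2))) := by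
      refine mul_le_mul hfb (hQe.trans ?_) (Real.exp_pos _).le hp₁
      exact le_mul_of_one_le_left (Real.exp_pos _).le h1
    have e3 : 0 ≤ p₁ * C * t * (‖h‖ ^ 3 * Real.exp (-(t * c * ‖h‖ ^ 2))) := by positivity
    have e4 : 0 ≤ K * (‖h‖ * Real.exp (-(t * c * ‖h‖ ^ 2))) := by positivity
    have e5 : 0 ≤ Real.exp (-D h) * f (b + h) := mul_nonneg (Real.exp_pos _).le (hf _)
    have e6 : 0 ≤ f b * Real.exp (-Q h) := mul_nonneg (hf _) (Real.exp_pos _).le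
    rw [abs_le]
    constructor <;> nlinarith

/-! ### Laplace's method with a uniform rate -/

section Laplace

variable {V : Type*} [NormedAddCommGroup V] [InnerProductSpace ℝ V] [FiniteDimensional ℝ V]
  [MeasurableSpace V] [BorelSpace V]

lemma eventually_exp_neg_mul_le {c : ℝ} (hc : 0 < c) (q : ℕ) :
    ∀ᶠ t : ℝ in atTop, Real.exp (-(t * c)) ≤ (√t ^ q)⁻¹ * (√t)⁻¹ := by
  have h := tendsto_rpow_mul_exp_neg_mul_atTop_nhds_zero (((q : ℝ) + 1) / 2) c hc
  filter_upwards [h.eventually (eventually_le_nhds (zero_lt_one)), eventually_gt_atTop 0] with t ht h0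
  have hs : 0 < √t := Real.sqrt_pos.2 h0
  have : t ^ (((q : ℝ) + 1) / 2) = √t ^ q * √t := by
    rw [← pow_succ, Real.sqrt_eq_rpow, ← Real.rpow_natCast, ← Real.rpow_mul h0.le]
    congr 1; push_cast; ring
  rw [this] at ht
  rw [← mul_inv, ← one_div, le_div_iff₀ (by positivity), mul_comm]
  convert ht using 3
  ring

/-- The Laplace method with a uniform rate: the integral of `exp (-D) f(b + ·)` is compared with
the one of `exp (-Q) f(b)`, where `D` and `Q` agree to third order at scale `t`. -/
lemma exists_laplace_bound {f : V → ℝ} (hf : ∀ v, 0 ≤ f v) (hfc : Continuous f)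
    (hf1 : ∫ v, f v = 1) {c Λ C K p₀ p₁ : ℝ} (hc : 0 < c) (hΛ : 0 < Λ) (hC : 0 ≤ C) (hK : 0 ≤ K)
    (hp₀ : 0 < p₀) (hp₁ : 0 ≤ p₁) :
    ∃ C', ∀ᶠ t : ℝ in atTop, ∀ (D Q : V → ℝ) (b : V), Continuous D → Continuous Q →
      (∀ h, t * c * (‖h‖ * min 1 ‖h‖) ≤ D h) → (∀ h, t * c * ‖h‖ ^ 2 ≤ Q h) →
      (∀ h, Q h ≤ t * Λ * ‖h‖ ^ 2) →
      (∀ h, ‖h‖ ≤ 1 → |D h - Q h| ≤ t * C * ‖h‖ ^ 3) →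
      (∀ h, ‖h‖ ≤ 1 → |f (b + h) - f b| ≤ K * ‖h‖) → p₀ ≤ f b → f b ≤ p₁ →
      0 < ∫ h, Real.exp (-D h) * f (b + h) ∧
      |Real.log (∫ h, Real.exp (-D h) * f (b + h)) - Real.log (f b * ∫ h, Real.exp (-Q h))|
        ≤ C' * (√t)⁻¹ := by
  have hfi : Integrable f := Integrable.of_integral_ne_zero (by rw [hf1]; exact one_ne_zero)
  set q := Module.finrank ℝ V with hq
  set m₃ := ∫ v : V, ‖v‖ ^ 3 * Real.exp (-(c * ‖v‖ ^ 2)) with hm₃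
  set m₁ := ∫ v : V, ‖v‖ ^ 1 * Real.exp (-(c * ‖v‖ ^ 2)) with hm₁
  set g₀ := ∫ v : V, Real.exp (-(Λ * ‖v‖ ^ 2)) with hg₀
  have hg₀pos : 0 < g₀ := integral_exp_neg_mul_sq_norm_pos hΛ
  have hm₃0 : 0 ≤ m₃ := integral_nonneg fun v => by positivity
  have hm₁0 : 0 ≤ m₁ := integral_nonneg fun v => by positivity
  -- The three summands account for the cubic error in the exponent, the variation of `f` together
  -- with the Gaussian tail, and the exponentially small remainder.
  set A := p₁ * C * m₃ + (K + p₁) * m₁ + 1 with hA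
  have hA0 : 0 < A := by positivity
  refine ⟨2 * (A / (p₀ * g₀)), ?_⟩
  have hlim : Tendsto (fun t : ℝ => A / (p₀ * g₀) * (√t)⁻¹) atTop (𝓝 0) := by
    have := (tendsto_inv_atTop_zero.comp Real.tendsto_sqrt_atTop).const_mul (A / (p₀ * g₀))
    simpa using this
  filter_upwards [eventually_exp_neg_mul_le hc q, eventually_gt_atTop 0,
    hlim.eventually (eventually_le_nhds (b := 1 / 2) (by norm_num))] with t hexp ht hsmall
  intro D Q b hDc hQc hD hQ hQΛ hDQ hfK hpb hbp
  have hs : 0 < √t := Real.sqrt_pos.2 ht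
  have hfb : Integrable fun h => f (b + h) := hfi.comp_add_left b
  have hfb1 : ∫ h, f (b + h) = 1 := by rw [integral_add_left_eq_self, hf1]
  have hint₁ : Integrable fun h => Real.exp (-D h) * f (b + h) := by
    refine hfb.mono' (Continuous.aestronglyMeasurable (by fun_prop)) (ae_of_all _ fun h => ?_)
    rw [Real.norm_of_nonneg (mul_nonneg (Real.exp_pos _).le (hf _))]
    refine mul_le_of_le_one_left (hf _) (Real.exp_le_one_iff.2 ?_)
    have : 0 ≤ t * c * (‖h‖ * min 1 ‖h‖) := by positivity
    linarith [hD h]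
  have hint₂ : Integrable fun h => Real.exp (-Q h) := by
    refine (integrable_exp_neg_mul_sq_norm (V := V) (mul_pos ht hc)).mono'
      (Continuous.aestronglyMeasurable (by fun_prop)) (ae_of_all _ fun h => ?_)
    rw [Real.norm_of_nonneg (Real.exp_pos _).le]
    exact Real.exp_le_exp.2 (by linarith [hQ h])
  set J := ∫ h, Real.exp (-D h) * f (b + h) with hJ
  set G := ∫ h, Real.exp (-Q h) with hG
  -- The upper bound on `Q` keeps `G` of order `√t ^ (-q)`, the same volume factor as in the error,
  -- so it cancels in the ratio.
  have hGlow : (√t ^ q)⁻¹ * g₀ ≤ G := by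
    have h1 := integral_pow_mul_exp_neg_mul_sq_norm_scale (V := V) Λ 0 ht
    simp only [pow_zero, one_mul, inv_one, mul_one] at h1
    rw [hg₀, ← h1]
    refine integral_mono (integrable_exp_neg_mul_sq_norm (mul_pos ht hΛ)) hint₂ fun h => ?_
    exact Real.exp_le_exp.2 (by linarith [hQΛ h])
  have hGpos : 0 < G := lt_of_lt_of_le (by positivity) hGlow
  have hfG : 0 < f b * G := mul_pos (hp₀.trans_le hpb) hGpos
  have hdiff : |J - f b * G| ≤ A * ((√t ^ q)⁻¹ * (√t)⁻¹) := by
    have i3 := integrable_pow_mul_exp_neg_mul_sq_norm (V := V) (mul_pos ht hc) 3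
    have i1 := integrable_pow_mul_exp_neg_mul_sq_norm (V := V) (mul_pos ht hc) 1
    have i31 : Integrable fun h : V => p₁ * C * t * (‖h‖ ^ 3 * Real.exp (-(t * c * ‖h‖ ^ 2)))
        + (K + p₁) * (‖h‖ ^ 1 * Real.exp (-(t * c * ‖h‖ ^ 2))) :=
      (i3.const_mul _).add (i1.const_mul _)
    rw [hJ, hG, ← integral_const_mul, ← integral_sub hint₁ (hint₂.const_mul _)]
    refine (abs_integral_le_integral_abs).trans ?_
    calc ∫ h, |Real.exp (-D h) * f (b + h) - f b * Real.exp (-Q h)|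
        ≤ ∫ h, (p₁ * C * t * (‖h‖ ^ 3 * Real.exp (-(t * c * ‖h‖ ^ 2)))
            + (K + p₁) * (‖h‖ ^ 1 * Real.exp (-(t * c * ‖h‖ ^ 2)))
            + Real.exp (-(t * c)) * f (b + h)) :=
          integral_mono (hint₁.sub (hint₂.const_mul _)).abs
            (i31.add (hfb.const_mul _))
            (abs_exp_mul_sub_exp_mul_le hc hC hK ht hf hD hQ hDQ hfK hbp)
      _ = p₁ * C * t * ((√t ^ q)⁻¹ * (√t ^ 3)⁻¹ * m₃)
            + (K + p₁) * ((√t ^ q)⁻¹ * (√t ^ 1)⁻¹ * m₁) + Real.exp (-(t * c)) := by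
          rw [integral_add i31 (hfb.const_mul _),
            integral_add (i3.const_mul _) (i1.const_mul _), integral_const_mul,
            integral_const_mul, integral_const_mul, hfb1,
            integral_pow_mul_exp_neg_mul_sq_norm_scale c 3 ht,
            integral_pow_mul_exp_neg_mul_sq_norm_scale c 1 ht, mul_one]
      _ ≤ p₁ * C * t * ((√t ^ q)⁻¹ * (√t ^ 3)⁻¹ * m₃)
            + (K + p₁) * ((√t ^ q)⁻¹ * (√t ^ 1)⁻¹ * m₁) + (√t ^ q)⁻¹ * (√t)⁻¹ := by gcongr
      _ = A * ((√t ^ q)⁻¹ * (√t)⁻¹) := by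
          have : t * (√t ^ 3)⁻¹ = (√t)⁻¹ := by
            nth_rewrite 1 [← Real.sq_sqrt ht.le]
            field_simp
          rw [hA]
          linear_combination p₁ * C * (√t ^ q)⁻¹ * m₃ * this
  have hratio : |J / (f b * G) - 1| ≤ A / (p₀ * g₀) * (√t)⁻¹ := by
    rw [div_sub_one hfG.ne', abs_div, abs_of_pos hfG, div_le_iff₀ hfG]
    refine hdiff.trans ?_
    have h1 : p₀ * ((√t ^ q)⁻¹ * g₀) ≤ f b * G :=
      mul_le_mul hpb hGlow (by positivity) (hp₀.le.trans hpb)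
    calc A * ((√t ^ q)⁻¹ * (√t)⁻¹) = A / (p₀ * g₀) * (√t)⁻¹ * (p₀ * ((√t ^ q)⁻¹ * g₀)) := by
          field_simp
      _ ≤ _ := by gcongr
  have hlog := abs_log_le_two_mul (hratio.trans hsmall)
  have hJpos : 0 < J := by
    have h1 := (abs_le.1 (hratio.trans hsmall)).1
    have h2 : 0 < J / (f b * G) := by linarith
    exact (div_pos_iff_of_pos_right hfG).1 h2
  refine ⟨hJpos, ?_⟩
  rw [← Real.log_div hJpos.ne' hfG.ne']
  linarith

end Laplace

variable {d p : ℕ} {I : Finset (Fin p)}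

/-- The second order part of the log-likelihood around `b`: up to the linear term, this is the
amount by which the log-likelihood at `b + h` falls short of the one at `b`. -/
noncomputable def logLikDrop (θ : ℝ) (W : Set (Space d)) (zl : Space d → Param I)
    (b h : Param I) : ℝ :=
  θ * ∫ u in W, Real.exp (inner ℝ b (zl u)) * expRem (inner ℝ h (zl u))

/-! ### Bounds for integrals over a window -/

section SetIntegral

variable {U : Type*} [TopologicalSpace U] [MeasurableSpace U] {m : Measure U} [IsFiniteMeasureOnCompacts m]

lemma mul_measureReal_le_setIntegral [OpensMeasurableSpace U] [T2Space U] {W B : Set U}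
    (hW : IsCompact W) (hBW : B ⊆ W) (hB : MeasurableSet B) {f : U → ℝ} (hf : Continuous f) (hf0 : ∀ u, 0 ≤ f u) {a : ℝ}
    (ha : ∀ u ∈ B, a ≤ f u) : m.real B * a ≤ ∫ u in W, f u ∂m := by
  have hi : IntegrableOn f W m := hf.continuousOn.integrableOn_compact hW
  have hBfin : m B ≠ ⊤ := ((measure_mono hBW).trans_lt hW.measure_lt_top).ne
  calc m.real B * a = ∫ _ in B, a ∂m := by rw [setIntegral_const, smul_eq_mul]
    _ ≤ ∫ u in B, f u ∂m :=
        setIntegral_mono_on (integrableOn_const hBfin) (hi.mono_set hBW) hB ha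
    _ ≤ ∫ u in W, f u ∂m :=
        setIntegral_mono_set hi (ae_of_all _ hf0) (LE.le.eventuallyLE hBW)

lemma abs_setIntegral_le {W : Set U} (hW : IsCompact W) {f : U → ℝ} {a : ℝ}
    (ha : ∀ u, |f u| ≤ a) : |∫ u in W, f u ∂m| ≤ a * m.real W := by
  have := norm_setIntegral_le_of_norm_le_const (μ := m) (f := f) (C := a) hW.measure_lt_top
    (fun u _ => ha u)
  simpa using this

end SetIntegral

/-! ### Expansion of the log-likelihood and bounds on its drop -/

section Bounds

variable {θ : ℝ} {W : Set (Space d)} {zl : Space d → Param I}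

lemma continuous_logLikDrop (hW : IsCompact W) (hz : Continuous zl) (b : Param I) :
    Continuous (logLikDrop θ W zl b) := by
  unfold logLikDrop
  refine continuous_const.mul (continuous_parametric_integral_of_continuous ?_ hW)
  have := continuous_expRem
  simp only [Function.uncurry_def]
  fun_prop

/-- The exact second order expansion of the log-likelihood. -/
lemma logLik_add (hW : IsCompact W) (hz : Continuous zl) {x : Set (Space d)}
    (hx : (x ∩ W).Finite) (b h : Param I) :
    logLik θ W zl x (b + h)
      = logLik θ W zl x b + inner ℝ h (score θ W zl x b) - logLikDrop θ W zl b h := by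
  have hi : ∀ {f : Space d → ℝ}, Continuous f → IntegrableOn f W := fun hf =>
    hf.continuousOn.integrableOn_compact hW
  have hiV : IntegrableOn (fun u => Real.exp (inner ℝ b (zl u)) • zl u) W :=
    ContinuousOn.integrableOn_compact hW (Continuous.continuousOn (by fun_prop))
  unfold logLik score logLikDrop expRem
  rw [finsum_mem_eq_finite_toFinset_sum _ hx, finsum_mem_eq_finite_toFinset_sum _ hx,
    finsum_mem_eq_finite_toFinset_sum _ hx, inner_sub_right, inner_smul_right, inner_sum,
    ← integral_inner hiV]
  have h1 : ∀ u, Real.exp (inner ℝ b (zl u))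
        * (Real.exp (inner ℝ h (zl u)) - 1 - inner ℝ h (zl u))
      = Real.exp (inner ℝ (b + h) (zl u)) - Real.exp (inner ℝ b (zl u))
        - inner ℝ h (Real.exp (inner ℝ b (zl u)) • zl u) := by
    intro u
    rw [inner_add_left, Real.exp_add, inner_smul_right]
    ring
  simp_rw [h1]
  rw [integral_sub (hi (f := fun u => Real.exp (inner ℝ (b + h) (zl u))
      - Real.exp (inner ℝ b (zl u))) (by fun_prop)) (hi (by fun_prop)),
    integral_sub (hi (by fun_prop)) (hi (by fun_prop))]
  simp_rw [inner_add_left]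
  rw [Finset.sum_add_distrib]
  ring

lemma continuous_logLik (hW : IsCompact W) (hz : Continuous zl) {x : Set (Space d)}
    (hx : (x ∩ W).Finite) : Continuous (logLik θ W zl x) := by
  have h : logLik θ W zl x = fun h => logLik θ W zl x 0 + inner ℝ h (score θ W zl x 0)
      - logLikDrop θ W zl 0 h := by
    ext h
    rw [← logLik_add hW hz hx, zero_add]
  rw [h]
  have := continuous_logLikDrop (θ := θ) hW hz 0
  fun_prop

/-- The quadratic form of the sensitivity matrix. -/
lemma dotProduct_sensitivity_mulVec (hW : IsCompact W) (hz : Continuous zl) (b h : Param I) :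
    h.ofLp ⬝ᵥ (sensitivity θ W zl b).mulVec h.ofLp
      = θ * ∫ u in W, inner ℝ h (zl u) ^ 2 * Real.exp (inner ℝ b (zl u)) := by
  have hzi : ∀ i, Continuous fun u => zl u i := fun i => by fun_prop
  have h1 : ∀ u, inner ℝ h (zl u) ^ 2 * Real.exp (inner ℝ b (zl u))
      = ∑ i, ∑ j, h i * h j * (zl u i * zl u j * Real.exp (inner ℝ b (zl u))) := by
    intro u
    have : inner ℝ h (zl u) = ∑ i, h i * zl u i := by
      simp [PiLp.inner_apply, mul_comm]
    rw [this, sq, Finset.sum_mul_sum, Finset.sum_mul]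
    refine Finset.sum_congr rfl fun i _ => ?_
    rw [Finset.sum_mul]
    refine Finset.sum_congr rfl fun j _ => ?_
    ring
  simp_rw [h1]
  have hi : ∀ i j, IntegrableOn
      (fun u => h i * h j * (zl u i * zl u j * Real.exp (inner ℝ b (zl u)))) W := fun i j =>
    ContinuousOn.integrableOn_compact hW (Continuous.continuousOn (by fun_prop))
  rw [integral_finsetSum _ fun i _ => integrable_finsetSum _ fun j _ => hi i j]
  simp_rw [integral_finsetSum Finset.univ fun j _ => hi _ j, integral_const_mul]
  simp only [dotProduct, Matrix.mulVec, sensitivity, Matrix.of_apply, Finset.mul_sum]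
  refine Finset.sum_congr rfl fun i _ => Finset.sum_congr rfl fun j _ => ?_
  ring

variable {c κ M R : ℝ}

lemma exists_subset_le_abs_inner
    (hB : ∀ φ : Param I, ‖φ‖ = 1 → ∃ B ⊆ W, MeasurableSet B ∧
      κ * volume.real W ≤ volume.real B ∧ ∀ u ∈ B, c ≤ |inner ℝ φ (zl u)|) (h : Param I) :
    ∃ B ⊆ W, MeasurableSet B ∧ κ * volume.real W ≤ volume.real B ∧
      ∀ u ∈ B, c * ‖h‖ ≤ |inner ℝ h (zl u)| := by
  rcases eq_or_ne h 0 with rfl | hh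
  -- For `h = 0` the inequality is trivial, but a set `B` is still needed; the intercept direction
  -- supplies a unit vector in every model.
  · obtain ⟨B, h1, h2, h3, -⟩ := hB (EuclideanSpace.single none 1) (by simp)
    exact ⟨B, h1, h2, h3, fun u _ => by simp⟩
  · have hn : 0 < ‖h‖ := norm_pos_iff.2 hh
    obtain ⟨B, h1, h2, h3, h4⟩ := hB (‖h‖⁻¹ • h) (by
      rw [norm_smul, norm_inv, norm_norm, inv_mul_cancel₀ hn.ne'])
    refine ⟨B, h1, h2, h3, fun u hu => ?_⟩
    have := h4 u hu
    rw [real_inner_smul_left, abs_mul, abs_of_pos (inv_pos.2 hn), inv_mul_eq_div,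
      le_div_iff₀ hn] at this
    exact this

lemma abs_inner_le (hM : ∀ u, ‖zl u‖ ≤ M) {b : Param I} (hb : ‖b‖ ≤ R) (u : Space d) :
    |inner ℝ b (zl u)| ≤ R * M :=
  (abs_real_inner_le_norm _ _).trans
    (mul_le_mul hb (hM u) (norm_nonneg _) ((norm_nonneg _).trans hb))

lemma exp_neg_le_exp_inner (hM : ∀ u, ‖zl u‖ ≤ M) {b : Param I} (hb : ‖b‖ ≤ R) (u : Space d) :
    Real.exp (-(R * M)) ≤ Real.exp (inner ℝ b (zl u)) :=
  Real.exp_le_exp.2 (neg_le_of_abs_le (abs_inner_le hM hb u))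

lemma exp_inner_le (hM : ∀ u, ‖zl u‖ ≤ M) {b : Param I} (hb : ‖b‖ ≤ R) (u : Space d) :
    Real.exp (inner ℝ b (zl u)) ≤ Real.exp (R * M) :=
  Real.exp_le_exp.2 (le_of_abs_le (abs_inner_le hM hb u))

/-- Only the contribution of `B` is kept, where `|⟨h, z⟩| ≥ c‖h‖`. Linear growth at infinity is
enough to dominate a small score term. -/
lemma le_logLikDrop (hθ : 0 ≤ θ) (hW : IsCompact W) (hz : Continuous zl)
    (hM : ∀ u, ‖zl u‖ ≤ M) (hc : 0 < c)
    (hB : ∀ φ : Param I, ‖φ‖ = 1 → ∃ B ⊆ W, MeasurableSet B ∧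
      κ * volume.real W ≤ volume.real B ∧ ∀ u ∈ B, c ≤ |inner ℝ φ (zl u)|)
    {b : Param I} (hb : ‖b‖ ≤ R) (h : Param I) :
    θ * volume.real W * (κ * Real.exp (-(R * M)) * min (c ^ 2 / 4) (c / 2)) * (‖h‖ * min 1 ‖h‖)
      ≤ logLikDrop θ W zl b h := by
  obtain ⟨B, hBW, hBm, hBκ, hBc⟩ := exists_subset_le_abs_inner hB h
  have hrem := continuous_expRem
  set c₂ := min (c ^ 2 / 4) (c / 2) with hc₂
  have hc₂0 : 0 ≤ c₂ := by positivity
  have hpt : ∀ u ∈ B, Real.exp (-(R * M)) * (c₂ * (‖h‖ * min 1 ‖h‖))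
      ≤ Real.exp (inner ℝ b (zl u)) * expRem (inner ℝ h (zl u)) := by
    intro u hu
    refine mul_le_mul (exp_neg_le_exp_inner hM hb u) ?_ (by positivity) (Real.exp_pos _).le
    refine le_trans ?_ (min_le_expRem (by positivity) (hBc u hu))
    refine le_min ?_ ?_
    · calc c₂ * (‖h‖ * min 1 ‖h‖) ≤ c ^ 2 / 4 * (‖h‖ * ‖h‖) := by
            gcongr
            · exact min_le_left _ _
            · exact min_le_right _ _
        _ = _ := by ring
    · calc c₂ * (‖h‖ * min 1 ‖h‖) ≤ c / 2 * (‖h‖ * 1) := by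
            gcongr
            · exact min_le_right _ _
            · exact min_le_left _ _
        _ = _ := by ring
  have hint := mul_measureReal_le_setIntegral (m := volume) hW hBW hBm
    (f := fun u => Real.exp (inner ℝ b (zl u)) * expRem (inner ℝ h (zl u)))
    (by fun_prop) (fun u => mul_nonneg (Real.exp_pos _).le (expRem_nonneg _)) hpt
  unfold logLikDrop
  calc _ = θ * (κ * volume.real W * (Real.exp (-(R * M)) * (c₂ * (‖h‖ * min 1 ‖h‖)))) := by ring
    _ ≤ θ * (volume.real B * (Real.exp (-(R * M)) * (c₂ * (‖h‖ * min 1 ‖h‖)))) := by gcongr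
    _ ≤ _ := by gcongr

lemma le_quadForm (hθ : 0 ≤ θ) (hW : IsCompact W) (hz : Continuous zl)
    (hM : ∀ u, ‖zl u‖ ≤ M) (hc : 0 < c)
    (hB : ∀ φ : Param I, ‖φ‖ = 1 → ∃ B ⊆ W, MeasurableSet B ∧
      κ * volume.real W ≤ volume.real B ∧ ∀ u ∈ B, c ≤ |inner ℝ φ (zl u)|)
    {b : Param I} (hb : ‖b‖ ≤ R) (h : Param I) :
    θ * volume.real W * (κ * Real.exp (-(R * M)) * c ^ 2) * ‖h‖ ^ 2
      ≤ θ * ∫ u in W, inner ℝ h (zl u) ^ 2 * Real.exp (inner ℝ b (zl u)) := by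
  obtain ⟨B, hBW, hBm, hBκ, hBc⟩ := exists_subset_le_abs_inner hB h
  have hpt : ∀ u ∈ B, (c * ‖h‖) ^ 2 * Real.exp (-(R * M))
      ≤ inner ℝ h (zl u) ^ 2 * Real.exp (inner ℝ b (zl u)) := by
    intro u hu
    rw [← sq_abs (inner ℝ h (zl u))]
    gcongr
    · exact hBc u hu
    · exact neg_le_of_abs_le (abs_inner_le hM hb u)
  have hint := mul_measureReal_le_setIntegral (m := volume) hW hBW hBm
    (f := fun u => inner ℝ h (zl u) ^ 2 * Real.exp (inner ℝ b (zl u)))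
    (by fun_prop) (fun u => by positivity) hpt
  calc _ = θ * (κ * volume.real W * ((c * ‖h‖) ^ 2 * Real.exp (-(R * M)))) := by ring
    _ ≤ θ * (volume.real B * ((c * ‖h‖) ^ 2 * Real.exp (-(R * M)))) := by gcongr
    _ ≤ _ := by gcongr

lemma quadForm_le (hθ : 0 ≤ θ) (hW : IsCompact W)
    (hM : ∀ u, ‖zl u‖ ≤ M) {b : Param I} (hb : ‖b‖ ≤ R) (h : Param I) :
    θ * ∫ u in W, inner ℝ h (zl u) ^ 2 * Real.exp (inner ℝ b (zl u))
      ≤ θ * volume.real W * (M ^ 2 * Real.exp (R * M)) * ‖h‖ ^ 2 := by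
  have := le_of_abs_le (abs_setIntegral_le (m := volume) hW
    (f := fun u => inner ℝ h (zl u) ^ 2 * Real.exp (inner ℝ b (zl u)))
    (a := (‖h‖ * M) ^ 2 * Real.exp (R * M)) fun u => by
      rw [abs_of_nonneg (by positivity), ← sq_abs (inner ℝ h (zl u))]
      gcongr
      · exact abs_inner_le hM le_rfl u
      · exact le_of_abs_le (abs_inner_le hM hb u))
  calc _ ≤ θ * ((‖h‖ * M) ^ 2 * Real.exp (R * M) * volume.real W) := by gcongr
    _ = _ := by ring

lemma logLikDrop_le (hθ : 0 ≤ θ) (hW : IsCompact W) (hM : ∀ u, ‖zl u‖ ≤ M) {b : Param I}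
    (hb : ‖b‖ ≤ R) {r : ℝ} {h : Param I} (hh : ‖h‖ ≤ r) :
    logLikDrop θ W zl b h
      ≤ θ * volume.real W * (M ^ 2 * Real.exp (r * M) * Real.exp (R * M)) * ‖h‖ ^ 2 := by
  have := le_of_abs_le (abs_setIntegral_le (m := volume) hW
    (f := fun u => Real.exp (inner ℝ b (zl u)) * expRem (inner ℝ h (zl u)))
    (a := Real.exp (R * M) * ((‖h‖ * M) ^ 2 * Real.exp (r * M))) fun u => by
      rw [abs_of_nonneg (mul_nonneg (Real.exp_pos _).le (expRem_nonneg _))]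
      refine mul_le_mul (exp_inner_le hM hb u) ((expRem_le _).trans ?_) (expRem_nonneg _)
        (Real.exp_pos _).le
      rw [← sq_abs (inner ℝ h (zl u))]
      gcongr
      · exact abs_inner_le hM le_rfl u
      · exact abs_inner_le hM hh u)
  unfold logLikDrop
  calc _ ≤ θ * (Real.exp (R * M) * ((‖h‖ * M) ^ 2 * Real.exp (r * M)) * volume.real W) := by gcongr
    _ = _ := by ring

lemma abs_logLikDrop_sub_le (hθ : 0 ≤ θ) (hW : IsCompact W) (hz : Continuous zl)
    (hM : ∀ u, ‖zl u‖ ≤ M) {b : Param I} (hb : ‖b‖ ≤ R) {h : Param I} (hh : ‖h‖ ≤ 1) :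
    |logLikDrop θ W zl b h
        - (θ * ∫ u in W, inner ℝ h (zl u) ^ 2 * Real.exp (inner ℝ b (zl u))) / 2|
      ≤ θ * volume.real W * (Real.exp (R * M) * M ^ 3 * Real.exp M) * ‖h‖ ^ 3 := by
  have hi : ∀ {f : Space d → ℝ}, Continuous f → IntegrableOn f W := fun hf =>
    hf.continuousOn.integrableOn_compact hW
  have hrem := continuous_expRem
  have heq : logLikDrop θ W zl b h
        - (θ * ∫ u in W, inner ℝ h (zl u) ^ 2 * Real.exp (inner ℝ b (zl u))) / 2
      = θ * ∫ u in W, Real.exp (inner ℝ b (zl u))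
          * (expRem (inner ℝ h (zl u)) - inner ℝ h (zl u) ^ 2 / 2) := by
    unfold logLikDrop
    rw [mul_div_assoc, ← integral_div, ← mul_sub, ← integral_sub (hi (by fun_prop)) (hi (by fun_prop))]
    congr 2 with u
    ring
  rw [heq, abs_mul, abs_of_nonneg hθ]
  have := abs_setIntegral_le (m := volume) hW
    (f := fun u => Real.exp (inner ℝ b (zl u))
      * (expRem (inner ℝ h (zl u)) - inner ℝ h (zl u) ^ 2 / 2))
    (a := Real.exp (R * M) * ((‖h‖ * M) ^ 3 * Real.exp M)) fun u => by
      rw [abs_mul, abs_of_pos (Real.exp_pos _)]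
      refine mul_le_mul (exp_inner_le hM hb u) ((abs_expRem_sub_le _).trans ?_) (abs_nonneg _)
        (Real.exp_pos _).le
      have hle := abs_inner_le hM (le_refl ‖h‖) u
      have hle₁ : |inner ℝ h (zl u)| ≤ M := by simpa using abs_inner_le hM hh u
      gcongr
      exact pow_nonneg ((abs_nonneg _).trans hle) 3
  calc _ ≤ θ * (Real.exp (R * M) * ((‖h‖ * M) ^ 3 * Real.exp M) * volume.real W) := by gcongr
    _ = _ := by ring

end Bounds

/-! ### Existence, location and uniqueness of maximizers -/

section Argmax

variable {θ : ℝ} {W : Set (Space d)} {zl : Space d → Param I} {x : Set (Space d)}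

/-- If the score at `b₀` is small, then the log-likelihood is larger at `b₀` than at any point
that is not close to `b₀`. -/
lemma logLik_lt_of_norm_score_lt (hW : IsCompact W) (hz : Continuous zl) (hx : (x ∩ W).Finite)
    {a δ : ℝ} (ha : 0 ≤ a) (hδ : 0 < δ) (hδ1 : δ ≤ 1) {b₀ : Param I}
    (hdrop : ∀ h, a * (‖h‖ * min 1 ‖h‖) ≤ logLikDrop θ W zl b₀ h)
    (hscore : ‖score θ W zl x b₀‖ < a * δ) {b : Param I} (hb : δ ≤ ‖b - b₀‖) :
    logLik θ W zl x b < logLik θ W zl x b₀ := by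
  have h := logLik_add (θ := θ) hW hz hx b₀ (b - b₀)
  rw [add_sub_cancel] at h
  have h1 := real_inner_le_norm (b - b₀) (score θ W zl x b₀)
  have h2 := hdrop (b - b₀)
  have h3 : a * δ ≤ a * min 1 ‖b - b₀‖ := mul_le_mul_of_nonneg_left (le_min hδ1 hb) ha
  have h4 : 0 < ‖b - b₀‖ := hδ.trans_le hb
  nlinarith

/-- A maximum over the compact `δ`-ball is global, because values outside are below the value at the
centre. -/
lemma exists_isArgmax_of_norm_score_lt (hW : IsCompact W) (hz : Continuous zl)
    (hx : (x ∩ W).Finite) {a δ : ℝ} (ha : 0 ≤ a) (hδ : 0 < δ) (hδ1 : δ ≤ 1) {b₀ : Param I}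
    (hdrop : ∀ h, a * (‖h‖ * min 1 ‖h‖) ≤ logLikDrop θ W zl b₀ h)
    (hscore : ‖score θ W zl x b₀‖ < a * δ) : ∃ b, IsArgmax (logLik θ W zl x) b := by
  obtain ⟨b, -, hmax⟩ := (isCompact_closedBall b₀ δ).exists_isMaxOn
    ⟨b₀, Metric.mem_closedBall_self hδ.le⟩ (continuous_logLik (θ := θ) hW hz hx).continuousOn
  refine ⟨b, fun b' => ?_⟩
  by_cases hb' : b' ∈ Metric.closedBall b₀ δ
  · exact hmax hb'
  · rw [mem_closedBall_iff_norm, not_le] at hb'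
    exact (logLik_lt_of_norm_score_lt hW hz hx ha hδ hδ1 hdrop hscore hb'.le).le.trans
      (hmax (Metric.mem_closedBall_self hδ.le))

lemma IsArgmax.norm_sub_lt (hW : IsCompact W) (hz : Continuous zl)
    (hx : (x ∩ W).Finite) {a δ : ℝ} (ha : 0 ≤ a) (hδ : 0 < δ) (hδ1 : δ ≤ 1) {b₀ b : Param I}
    (hdrop : ∀ h, a * (‖h‖ * min 1 ‖h‖) ≤ logLikDrop θ W zl b₀ h)
    (hscore : ‖score θ W zl x b₀‖ < a * δ) (hb : IsArgmax (logLik θ W zl x) b) :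
    ‖b - b₀‖ < δ := by
  by_contra! h
  exact absurd (hb b₀) (not_le.2 (logLik_lt_of_norm_score_lt hW hz hx ha hδ hδ1 hdrop hscore h))

/-- The first order condition at a maximizer of the log-likelihood. -/
lemma IsArgmax.score_eq_zero (hθ : 0 ≤ θ) (hW : IsCompact W) (hz : Continuous zl)
    (hx : (x ∩ W).Finite) {M : ℝ} (hM : ∀ u, ‖zl u‖ ≤ M) {b : Param I}
    (hb : IsArgmax (logLik θ W zl x) b) : score θ W zl x b = 0 := by
  set s := score θ W zl x b with hs
  set K := θ * volume.real W * (M ^ 2 * Real.exp (‖s‖ * M) * Real.exp (‖b‖ * M)) with hK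
  have hK0 : 0 ≤ K := by positivity
  -- A short gradient step: this choice gives `1 - K * t = t > 0`, so a nonzero score would increase
  -- the log-likelihood.
  set t := (1 + K)⁻¹ with ht
  have ht0 : 0 < t := by positivity
  have ht1 : t ≤ 1 := inv_le_one_of_one_le₀ (by linarith)
  have h1 := logLik_add (θ := θ) hW hz hx b (t • s)
  have h2 := hb (b + t • s)
  have hn : ‖t • s‖ = t * ‖s‖ := by rw [norm_smul, Real.norm_of_nonneg ht0.le]
  have h3 : logLikDrop θ W zl b (t • s) ≤ K * (t * ‖s‖) ^ 2 := by
    rw [← hn]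
    refine logLikDrop_le hθ hW hM le_rfl ?_
    rw [hn]
    exact mul_le_of_le_one_left (norm_nonneg _) ht1
  rw [← hs, real_inner_smul_left, real_inner_self_eq_norm_sq] at h1
  have h4 : t * ‖s‖ ^ 2 * (1 - K * t) ≤ 0 := by nlinarith
  have h5 : 1 - K * t = t := by rw [ht]; field_simp; ring
  rw [h5] at h4
  have h6 : ‖s‖ ^ 2 ≤ 0 := by
    by_contra! hpos
    have : 0 < t * ‖s‖ ^ 2 * t := by positivity
    linarith
  exact norm_eq_zero.1 (pow_eq_zero_iff two_ne_zero |>.1 (le_antisymm h6 (sq_nonneg _)))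

lemma IsArgmax.eq_of_drop (hθ : 0 ≤ θ) (hW : IsCompact W) (hz : Continuous zl)
    (hx : (x ∩ W).Finite) {M : ℝ} (hM : ∀ u, ‖zl u‖ ≤ M) {a : ℝ} (ha : 0 < a) {b b' : Param I}
    (hdrop : ∀ h, a * (‖h‖ * min 1 ‖h‖) ≤ logLikDrop θ W zl b h)
    (hb : IsArgmax (logLik θ W zl x) b) (hb' : IsArgmax (logLik θ W zl x) b') : b' = b := by
  have h := logLik_add (θ := θ) hW hz hx b (b' - b)
  rw [add_sub_cancel, hb.score_eq_zero hθ hW hz hx hM, inner_zero_right, add_zero] at h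
  by_contra hne
  have hpos : 0 < ‖b' - b‖ := norm_pos_iff.2 (sub_ne_zero.2 hne)
  have h1 : 0 < a * (‖b' - b‖ * min 1 ‖b' - b‖) := by positivity
  linarith [hb' b, hdrop (b' - b)]

end Argmax

/-! ### The marginal likelihood as a Laplace integral -/

section Marginal

variable {θ : ℝ} {W : Set (Space d)} {zl : Space d → Param I} {x : Set (Space d)}

lemma poissonDensity_eq (hx : (x ∩ W).Finite) (β : Param I) :
    poissonDensity θ W zl x β
      = Real.exp (volume.real W) * θ ^ (x ∩ W).ncard * Real.exp (logLik θ W zl x β) := by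
  unfold poissonDensity logLik rho
  rw [finprod_mem_eq_finite_toFinset_prod _ hx, finsum_mem_eq_finite_toFinset_sum _ hx,
    Finset.prod_mul_distrib, Finset.prod_const, ← Real.exp_sum, integral_const_mul,
    Set.ncard_eq_toFinset_card _ hx, Real.exp_sub, Real.exp_sub]
  ring

lemma marginalDensity_eq (hx : (x ∩ W).Finite) (prior : Param I → ℝ) :
    marginalDensity θ W zl prior x
      = Real.exp (volume.real W) * θ ^ (x ∩ W).ncard * marginalLik θ W zl prior x := by
  unfold marginalDensity marginalLik
  rw [← integral_const_mul]
  congr 1 with β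
  rw [poissonDensity_eq hx, mul_assoc]

lemma log_marginalDensity (hθ : 0 < θ) (hx : (x ∩ W).Finite) {prior : Param I → ℝ}
    (hpos : 0 < marginalLik θ W zl prior x) :
    Real.log (marginalDensity θ W zl prior x)
      = volume.real W + ((x ∩ W).ncard : ℝ) * Real.log θ
        + Real.log (marginalLik θ W zl prior x) := by
  rw [marginalDensity_eq hx, Real.log_mul (by positivity) hpos.ne',
    Real.log_mul (Real.exp_pos _).ne' (by positivity), Real.log_exp, Real.log_pow]

lemma marginalLik_eq (hW : IsCompact W) (hz : Continuous zl) (hx : (x ∩ W).Finite)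
    (prior : Param I → ℝ) {b : Param I} (hb : score θ W zl x b = 0) :
    marginalLik θ W zl prior x
      = Real.exp (logLik θ W zl x b) * ∫ h, Real.exp (-logLikDrop θ W zl b h) * prior (b + h) := by
  unfold marginalLik
  rw [← integral_add_left_eq_self _ b, ← integral_const_mul]
  congr 1 with h
  rw [logLik_add hW hz hx, hb, inner_zero_right, add_zero, sub_eq_add_neg, Real.exp_add, mul_assoc]

/-- The scale `μ` is only a normalization: `det (μ⁻¹ S) = μ ^ (-p_l) det S` cancels the `log μ`
term, so any positive `μ` is allowed. -/
lemma laplaceTerms_eq {prior : Param I → ℝ} {μ : ℝ} (hμ : 0 < μ) {b : Param I}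
    (hS : (sensitivity θ W zl b).PosDef) (hprior : 0 < prior b) :
    laplaceTerms θ W zl prior μ x b = logLik θ W zl x b
      + Real.log (prior b * ∫ h : Param I,
          Real.exp (-((h.ofLp ⬝ᵥ (sensitivity θ W zl b).mulVec h.ofLp) / 2))) := by
  have hdet := hS.det_pos
  have hcard : (Fintype.card (Option I) : ℝ) = (I.card : ℝ) + 1 := by simp
  rw [integral_exp_neg_half_quadForm hS, Real.log_mul hprior.ne' (by positivity),
    Real.log_mul (by positivity) (by positivity), Real.log_rpow (by positivity), Real.log_inv,
    Real.log_sqrt hdet.le, hcard]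
  unfold laplaceTerms
  rw [Matrix.det_smul, Real.log_mul (by positivity) hdet.ne', Real.log_pow, Real.log_inv, hcard]
  ring

end Marginal

lemma exists_lipschitz_near {V : Type*} [NormedAddCommGroup V] [NormedSpace ℝ V]
    [FiniteDimensional ℝ V] {f : V → ℝ} (hf : ContDiff ℝ 1 f) (b₀ : V) :
    ∃ K, 0 ≤ K ∧ ∀ b, ‖b - b₀‖ ≤ 1 → ∀ h, ‖h‖ ≤ 1 → |f (b + h) - f b| ≤ K * ‖h‖ := by
  have : ProperSpace V := FiniteDimensional.proper ℝ V
  -- Radius 2 accommodates both `b` and `b + h`, so the mean value inequality applies on one convex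
  -- ball.
  obtain ⟨K, hK⟩ := (isCompact_closedBall b₀ 2).exists_bound_of_continuousOn
    (hf.continuous_fderiv one_ne_zero).continuousOn
  refine ⟨K, (norm_nonneg _).trans (hK b₀ (Metric.mem_closedBall_self (by norm_num))), ?_⟩
  intro b hb h hh
  have := (convex_closedBall b₀ 2).norm_image_sub_le_of_norm_fderiv_le (𝕜 := ℝ) (f := f)
    (x := b) (y := b + h) (fun v _ => (hf.differentiable one_ne_zero) v) hK
    (by rw [mem_closedBall_iff_norm]; linarith)
    (by
      rw [mem_closedBall_iff_norm, add_sub_right_comm]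
      linarith [norm_add_le (b - b₀) h])
  simpa using this

/-! ### Consistency and the expansion along the sequence -/

section Asymptotics

variable {W : ℕ → Set (Space d)} {θ τ : ℕ → ℝ} {zl : Space d → Param I}
  {x : ℕ → Set (Space d)} {βstar βhat : ℕ → Param I} {βlim : Param I} {c κ M : ℝ}

/-- Existence, uniqueness and consistency of the maximum likelihood estimator. -/
lemma eventually_isArgmax_and_tendsto (hW : ∀ n, IsCompact (W n)) (hz : Continuous zl)
    (hM : ∀ u, ‖zl u‖ ≤ M) (hx : ∀ n, (x n ∩ W n).Finite) (hθ : ∀ᶠ n in atTop, 0 < θ n)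
    (hτ : ∀ n, τ n = θ n * volume.real (W n)) (hτpos : ∀ᶠ n in atTop, 0 < τ n)
    (hc : 0 < c) (hκ : 0 < κ)
    (hB : ∀ᶠ n in atTop, ∀ φ : Param I, ‖φ‖ = 1 → ∃ B ⊆ W n, MeasurableSet B ∧
        κ * volume.real (W n) ≤ volume.real B ∧ ∀ u ∈ B, c ≤ |inner ℝ φ (zl u)|)
    (hβstar : Tendsto βstar atTop (𝓝 βlim))
    (hscore : Tendsto (fun n => (τ n)⁻¹ • score (θ n) (W n) zl (x n) (βstar n)) atTop (𝓝 0))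
    (hβhat : ∀ n, (∃ b, IsArgmax (logLik (θ n) (W n) zl (x n)) b) →
      IsArgmax (logLik (θ n) (W n) zl (x n)) (βhat n)) :
    (∀ᶠ n in atTop, IsArgmax (logLik (θ n) (W n) zl (x n)) (βhat n) ∧
      ∀ b, IsArgmax (logLik (θ n) (W n) zl (x n)) b → b = βhat n) ∧
    Tendsto βhat atTop (𝓝 βlim) := by
  have hstarbdd : ∀ᶠ n in atTop, ‖βstar n‖ ≤ ‖βlim‖ + 1 :=
    (hβstar.norm.eventually (eventually_lt_nhds (lt_add_one _))).mono fun n h => h.le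
  set c₁ := κ * Real.exp (-((‖βlim‖ + 1) * M)) * min (c ^ 2 / 4) (c / 2) with hc₁
  have hc₁0 : 0 < c₁ := by positivity
  have hclose : ∀ δ, 0 < δ → δ ≤ 1 → ∀ᶠ n in atTop,
      (∃ b, IsArgmax (logLik (θ n) (W n) zl (x n)) b) ∧
      ∀ b, IsArgmax (logLik (θ n) (W n) zl (x n)) b → ‖b - βstar n‖ < δ := by
    intro δ hδ hδ1
    have hs := hscore.norm.eventually (eventually_lt_nhds (b := c₁ * δ) (by simp; positivity))
    filter_upwards [hs, hθ, hτpos, hB, hstarbdd] with n hsn hθn hτn hBn hbn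
    have hdrop : ∀ h, τ n * c₁ * (‖h‖ * min 1 ‖h‖) ≤ logLikDrop (θ n) (W n) zl (βstar n) h := by
      rw [hτ n]
      exact le_logLikDrop hθn.le (hW n) hz hM hc hBn hbn
    have hsc : ‖score (θ n) (W n) zl (x n) (βstar n)‖ < τ n * c₁ * δ := by
      rw [norm_smul, norm_inv, Real.norm_of_nonneg hτn.le, inv_mul_eq_div, div_lt_iff₀ hτn] at hsn
      linarith
    have ha : 0 ≤ τ n * c₁ := by positivity
    exact ⟨exists_isArgmax_of_norm_score_lt (hW n) hz (hx n) ha hδ hδ1 hdrop hsc,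
      fun b hb => hb.norm_sub_lt (hW n) hz (hx n) ha hδ hδ1 hdrop hsc⟩
  refine ⟨?_, ?_⟩
  · filter_upwards [hclose 1 one_pos le_rfl, hθ, hτpos, hB] with n hn hθn hτn hBn
    have hmax := hβhat n hn.1
    refine ⟨hmax, fun b hb => ?_⟩
    -- Uniqueness is argued for each `n` separately, so the constant may depend on `‖βhat n‖`.
    refine IsArgmax.eq_of_drop hθn.le (hW n) hz (hx n) hM
      (a := τ n * (κ * Real.exp (-(‖βhat n‖ * M)) * min (c ^ 2 / 4) (c / 2))) (by positivity)
      ?_ hmax hb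
    rw [hτ n]
    exact le_logLikDrop hθn.le (hW n) hz hM hc hBn le_rfl
  · have hdiff : Tendsto (fun n => βhat n - βstar n) atTop (𝓝 0) := by
      rw [Metric.tendsto_nhds]
      intro ε hε
      filter_upwards [hclose (min ε 1) (by positivity) (min_le_right _ _)] with n hn
      rw [dist_zero_right]
      exact (hn.2 _ (hβhat n hn.1)).trans_le (min_le_left _ _)
    simpa using hdiff.add hβstar

/-- The Laplace expansion of the marginal likelihood, with the error measured by `τ`. -/
lemma exists_eventually_abs_log_marginalLik_sub_le (hW : ∀ n, IsCompact (W n))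
    (hz : Continuous zl) (hM0 : 0 < M) (hM : ∀ u, ‖zl u‖ ≤ M) (hx : ∀ n, (x n ∩ W n).Finite)
    (hθ : ∀ᶠ n in atTop, 0 < θ n) (hτ : ∀ n, τ n = θ n * volume.real (W n))
    (hτlim : Tendsto τ atTop atTop) (hc : 0 < c) (hκ : 0 < κ)
    (hB : ∀ᶠ n in atTop, ∀ φ : Param I, ‖φ‖ = 1 → ∃ B ⊆ W n, MeasurableSet B ∧
        κ * volume.real (W n) ≤ volume.real B ∧ ∀ u ∈ B, c ≤ |inner ℝ φ (zl u)|)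
    (hS : ∀ n β, (sensitivity (θ n) (W n) zl β).PosDef)
    (hargmax : ∀ᶠ n in atTop, IsArgmax (logLik (θ n) (W n) zl (x n)) (βhat n))
    (hβhat : Tendsto βhat atTop (𝓝 βlim)) {prior : Param I → ℝ} (hprior : ∀ β, 0 ≤ prior β)
    (hprior1 : ∫ β, prior β = 1) (hpriorC : ContDiff ℝ 1 prior) (hpos : 0 < prior βlim)
    {μ : ℕ → ℝ} (hμ : ∀ᶠ n in atTop, 0 < μ n) :
    ∃ C, ∀ᶠ n in atTop, 0 < marginalLik (θ n) (W n) zl prior (x n) ∧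
      |Real.log (marginalLik (θ n) (W n) zl prior (x n))
        - laplaceTerms (θ n) (W n) zl prior (μ n) (x n) (βhat n)| ≤ C * (√(τ n))⁻¹ := by
  obtain ⟨K, hK0, hK⟩ := exists_lipschitz_near hpriorC βlim
  set R := ‖βlim‖ + 1 with hR
  set c₁ := κ * Real.exp (-(R * M)) * min (c ^ 2 / 4) (c / 2) with hc₁
  -- `Q` is half the quadratic form, hence the `/ 2` in `Λ`. By consistency the prior at the
  -- estimator eventually lies between half and twice its positive limit.
  obtain ⟨C, hC⟩ := exists_laplace_bound hprior hpriorC.continuous hprior1 (c := c₁)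
    (Λ := M ^ 2 * Real.exp (R * M) / 2) (C := Real.exp (R * M) * M ^ 3 * Real.exp M) (K := K)
    (p₀ := prior βlim / 2) (p₁ := 2 * prior βlim) (by positivity) (by positivity) (by positivity)
    hK0 (by positivity) (by positivity)
  refine ⟨C, ?_⟩
  have hpt : Tendsto (fun n => prior (βhat n)) atTop (𝓝 (prior βlim)) :=
    (hpriorC.continuous.tendsto βlim).comp hβhat
  have hnear : ∀ᶠ n in atTop, ‖βhat n - βlim‖ ≤ 1 := by
    filter_upwards [hβhat.eventually (Metric.closedBall_mem_nhds βlim one_pos)] with n hn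
    rwa [dist_eq_norm] at hn
  filter_upwards [hτlim.eventually hC, hθ, hB, hargmax, hμ, hnear,
    hpt.eventually (eventually_ge_nhds (half_lt_self hpos)),
    hpt.eventually (eventually_le_nhds (b := 2 * prior βlim) (by linarith))]
    with n hCn hθn hBn hmax hμn hn hp₀ hp₁
  have hbR : ‖βhat n‖ ≤ R := by
    have := norm_add_le (βhat n - βlim) βlim
    rw [sub_add_cancel] at this
    linarith
  have hscore := hmax.score_eq_zero hθn.le (hW n) hz (hx n) hM
  obtain ⟨hJ, hlog⟩ := hCn (logLikDrop (θ n) (W n) zl (βhat n))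
    (fun h => (h.ofLp ⬝ᵥ (sensitivity (θ n) (W n) zl (βhat n)).mulVec h.ofLp) / 2) (βhat n)
    (continuous_logLikDrop (hW n) hz _)
    (by simp only [dotProduct, Matrix.mulVec]; fun_prop)
    (by rw [hτ n]; exact le_logLikDrop hθn.le (hW n) hz hM hc hBn hbR)
    (by
      intro h
      rw [dotProduct_sensitivity_mulVec (hW n) hz, hτ n]
      have h1 := le_quadForm hθn.le (hW n) hz hM hc hBn hbR h
      -- The constant for the drop also serves for `Q`, as `c²/4 ≤ c²/2`.
      have h2 : c₁ ≤ κ * Real.exp (-(R * M)) * c ^ 2 / 2 := by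
        rw [hc₁, mul_div_assoc]
        gcongr
        exact (min_le_left _ _).trans (by linarith [sq_nonneg c])
      have h3 : θ n * volume.real (W n) * c₁ * ‖h‖ ^ 2
          ≤ θ n * volume.real (W n) * (κ * Real.exp (-(R * M)) * c ^ 2 / 2) * ‖h‖ ^ 2 := by gcongr
      linarith)
    (by
      intro h
      rw [dotProduct_sensitivity_mulVec (hW n) hz, hτ n]
      have h1 := quadForm_le hθn.le (hW n) hM hbR h
      linarith)
    (by
      intro h hh
      rw [dotProduct_sensitivity_mulVec (hW n) hz, hτ n]
      exact abs_logLikDrop_sub_le hθn.le (hW n) hz hM hbR hh)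
    (hK _ hn) hp₀ hp₁
  rw [marginalLik_eq (hW n) hz (hx n) prior hscore,
    laplaceTerms_eq hμn (hS n _) (by linarith)]
  refine ⟨by positivity, ?_⟩
  rw [Real.log_mul (Real.exp_pos _).ne' hJ.ne', Real.log_exp, add_sub_add_left_eq_sub]
  exact hlog

end Asymptotics

/-- Inversion reverses the comparison, so the bound `μ = O(τ)` is the one required. -/
lemma isBigO_inv_sqrt_rpow_neg_half {μ τ : ℕ → ℝ} (h : μ =O[atTop] τ) (hμ : ∀ᶠ n in atTop, 0 < μ n)
    (hτ : ∀ᶠ n in atTop, 0 < τ n) :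
    (fun n => (√(τ n))⁻¹) =O[atTop] fun n => (μ n) ^ (-(1 / 2) : ℝ) := by
  have h1 : (fun n => μ n ^ (1 / 2 : ℝ)) =O[atTop] fun n => τ n ^ (1 / 2 : ℝ) :=
    h.rpow (by norm_num) (hτ.mono fun n hn => hn.le)
  have h2 := h1.inv_rev (hμ.mono fun n hn h0 => absurd h0 (by positivity))
  refine h2.congr' (Eventually.of_forall fun n => ?_) ?_
  · simp only [Real.sqrt_eq_rpow]
  · filter_upwards [hμ] with n hn
    rw [Real.rpow_neg hn.le]

end PointProcessBIC

theorem proposition2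
    {Ω : Type*} [MeasurableSpace Ω] (P : Measure Ω) [IsProbabilityMeasure P]
    {d p : ℕ}
    -- the point processes, the observation windows and the known scale factors
    (X : ℕ → Ω → Set (PointProcessBIC.Space d))
    (hX : ∀ n, PointProcessBIC.IsPointProcess P (X n))
    (W : ℕ → Set (PointProcessBIC.Space d)) (θ : ℕ → ℝ)
    -- the covariates and the model
    (z : Fin p → PointProcessBIC.Space d → ℝ) (I : Finset (Fin p))
    (zl : PointProcessBIC.Space d → PointProcessBIC.Param I)
    (hzl : zl = PointProcessBIC.covVec z I)
    -- the least wrong parameter values, defined for large `n`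
    (βstar : ℕ → PointProcessBIC.Param I)
    (hβstar : ∀ᶠ n in atTop, PointProcessBIC.IsArgmax
      (fun β => ∫ ω, PointProcessBIC.logLik (θ n) (W n) zl (X n ω) β ∂P) (βstar n))
    -- the estimator: a maximizer of the likelihood whenever there is one
    (βhat : ℕ → Ω → PointProcessBIC.Param I)
    (hβhat : ∀ n ω,
      (∃ b, PointProcessBIC.IsArgmax (PointProcessBIC.logLik (θ n) (W n) zl (X n ω)) b) →
      PointProcessBIC.IsArgmax (PointProcessBIC.logLik (θ n) (W n) zl (X n ω)) (βhat n ω))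
    (prior : PointProcessBIC.Param I → ℝ)
    (τ : ℕ → ℝ) (hτ : ∀ n, τ n = θ n * volume.real (W n))
    (μ : ℕ → ℝ) (hμ : ∀ n, μ n = PointProcessBIC.meanCount P (X n) (W n))
    -- (C1') the least wrong parameter values converge
    (βlim : PointProcessBIC.Param I) (hC1 : Tendsto βstar atTop (𝓝 βlim))
    -- (C2) continuous covariates, with norm bounded and bounded away from zero
    (hC2_cont : Continuous zl)
    (hC2_bdd : ∃ m M : ℝ, 0 < m ∧ ∀ u, m ≤ ‖zl u‖ ∧ ‖zl u‖ ≤ M)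
    -- (C3) the double asymptotic framework
    (hC3_mono : Monotone τ) (hC3_θ : ∃ a : ℝ, 0 < a ∧ ∀ᶠ n in atTop, a ≤ θ n)
    (hC3_τ : Tendsto τ atTop atTop)
    (hC3_W : ∀ n, Convex ℝ (W n) ∧ IsCompact (W n))
    -- (C4) law of large numbers for the score
    (hC4 : ∀ᵐ ω ∂P, Tendsto
      (fun n => (τ n)⁻¹ • PointProcessBIC.score (θ n) (W n) zl (X n ω) (βstar n)) atTop (𝓝 0))
    -- (C5) nondegeneracy of the covariates
    (hC5_pos : ∀ n β, (PointProcessBIC.sensitivity (θ n) (W n) zl β).PosDef)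
    (hC5_B : ∃ c κ : ℝ, 0 < c ∧ 0 < κ ∧ ∀ᶠ n in atTop,
      ∀ φ : PointProcessBIC.Param I, ‖φ‖ = 1 → ∃ B ⊆ W n, MeasurableSet B ∧
        κ * volume.real (W n) ≤ volume.real B ∧ ∀ u ∈ B, c ≤ |inner ℝ φ (zl u)|)
    -- (C8) a continuously differentiable prior probability density, positive at the limit
    (hC8_nonneg : ∀ β, 0 ≤ prior β) (hC8_int : ∫ β, prior β = 1)
    (hC8_diff : ContDiff ℝ 1 prior) (hC8_pos : 0 < prior βlim)
    -- (C9) the mean number of points has the order of `τ`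
    (hC9 : μ =Θ[atTop] τ) :
    ∀ᵐ ω ∂P,
      (∀ᶠ n in atTop,
        PointProcessBIC.IsArgmax (PointProcessBIC.logLik (θ n) (W n) zl (X n ω)) (βhat n ω) ∧
        ∀ b, PointProcessBIC.IsArgmax (PointProcessBIC.logLik (θ n) (W n) zl (X n ω)) b →
          b = βhat n ω) ∧
      ((fun n => Real.log (PointProcessBIC.marginalLik (θ n) (W n) zl prior (X n ω))
          - PointProcessBIC.laplaceTerms (θ n) (W n) zl prior (μ n) (X n ω) (βhat n ω))
        =O[atTop] fun n => (μ n) ^ (-(1 / 2) : ℝ)) ∧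
      ((fun n => Real.log (PointProcessBIC.marginalDensity (θ n) (W n) zl prior (X n ω))
          - (volume.real (W n) + ((X n ω ∩ W n).ncard : ℝ) * Real.log (θ n)
            + PointProcessBIC.laplaceTerms (θ n) (W n) zl prior (μ n) (X n ω) (βhat n ω)))
        =O[atTop] fun n => (μ n) ^ (-(1 / 2) : ℝ)) := by
  obtain ⟨m, M, hm, hmM⟩ := hC2_bdd
  obtain ⟨c, κ, hc, hκ, hB⟩ := hC5_B
  obtain ⟨a, ha, hθa⟩ := hC3_θ
  have hM0 : 0 < M := hm.trans_le ((hmM 0).1.trans (hmM 0).2)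
  have hM : ∀ u, ‖zl u‖ ≤ M := fun u => (hmM u).2
  have hθ : ∀ᶠ n in atTop, 0 < θ n := hθa.mono fun n hn => ha.trans_le hn
  have hW : ∀ n, IsCompact (W n) := fun n => (hC3_W n).2
  have hτpos : ∀ᶠ n in atTop, 0 < τ n := hC3_τ.eventually_gt_atTop 0
  have hμ0 : ∀ n, 0 ≤ μ n := fun n => by
    rw [hμ n]
    exact integral_nonneg fun ω => Nat.cast_nonneg _
  -- From `τ = O(μ)`, a zero of `μ n` would eventually force `τ n = 0`.
  have hμpos : ∀ᶠ n in atTop, 0 < μ n := by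
    filter_upwards [hC9.isBigO_symm.eq_zero_imp, hτpos] with n hn hτn
    exact lt_of_le_of_ne (hμ0 n) fun h0 => hτn.ne' (hn h0.symm)
  have hfin : ∀ᵐ ω ∂P, ∀ n, (X n ω ∩ W n).Finite :=
    ae_all_iff.2 fun n => (hX n).locallyFinite.mono fun ω hω => hω _ (hW n).isBounded
  filter_upwards [hC4, hfin] with ω hscore hx
  obtain ⟨hmax, hlim⟩ := PointProcessBIC.eventually_isArgmax_and_tendsto hW hC2_cont hM hx hθ hτ
    hτpos hc hκ hB hC1 hscore (fun n => hβhat n ω)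
  obtain ⟨C, hC⟩ := PointProcessBIC.exists_eventually_abs_log_marginalLik_sub_le hW hC2_cont hM0
    hM hx hθ hτ hC3_τ hc hκ hB hC5_pos (hmax.mono fun n hn => hn.1) hlim hC8_nonneg hC8_int
    hC8_diff hC8_pos hμpos
  have hO := PointProcessBIC.isBigO_inv_sqrt_rpow_neg_half hC9.isBigO hμpos hτpos
  have hLik : (fun n => Real.log (PointProcessBIC.marginalLik (θ n) (W n) zl prior (X n ω))
      - PointProcessBIC.laplaceTerms (θ n) (W n) zl prior (μ n) (X n ω) (βhat n ω))
      =O[atTop] fun n => (μ n) ^ (-(1 / 2) : ℝ) := by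
    refine IsBigO.trans (IsBigO.of_bound C ?_) hO
    filter_upwards [hC] with n hn
    rw [Real.norm_eq_abs, Real.norm_of_nonneg (by positivity)]
    exact hn.2
  refine ⟨hmax, hLik, hLik.congr' ?_ EventuallyEq.rfl⟩
  filter_upwards [hC, hθ] with n hn hθn
  rw [PointProcessBIC.log_marginalDensity hθn (hx n) hn.1]
  ring
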